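/- Let $X$ be a set, $F=F(X)$ the free group on $X$, $N\unlhd F$ a normal subgroup, $N'=[N,N]$, and let $w\mapsto\bar w$ be the canonical epimorphism $F\to F/N$. For a subgroup $H\le F$ let $\mathrm{Sch}(X;H)$ be the Schreier graph whose vertices are the right cosets $Hg$ ($g\in F$) and whose edges are $Hg\stackrel{x}{\to}Hgx$ with $g\in F$, $x\in X^{\pm1}$; the edge $Hgx\stackrel{x^{-1}}{\to}Hg$ is the inverse $e^{-1}$ of $e=(Hg\stackrel{x}{\to}Hgx)$. For $w\in F$ the flow $\pi_w^{\mathrm{Sch}(X;H)}$ is the integer function on edges whose value at $e$ is the number of times the path that starts at the root $H$ and is labelled by the reduced word $w$ traverses $e$, minus the number of times it traverses $e^{-1}$. Let $\Gamma=\mathrm{Cay}(X;N)=\mathrm{Sch}(X;N)$. The group $F/N$ acts on finitely supported integer functions $f$ on the edges of $\Gamma$ by $(gf)(e)=f(g^{-1}e)$, where $F/N$ acts on the edges of $\Gamma$ by left multiplication. Let $u,v\in F$ and $\Delta=\mathrm{Sch}(X;\langle N,u\rangle)$. The natural projection $\Gamma\to\Delta$ induces the homomorphism $\rho$ sending $f$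 to the function $\rho(f)(e')=\sum_{e\mapsto e'}f(e)$ on the edges of $\Delta$. For $c\in F$ the $\bar c$-shift of the flow of $v$ in $\Delta$ is $\bar c\,\pi_v^\Delta:=\rho(\bar c\,\pi_v^\Gamma)$. **Theorem.** The images of $u$ and $v$ are conjugate in $F/N'$ if and only if there exists a single $c\in F$ satisfying both (a) $\pi_u^\Delta=\bar c\,\pi_v^\Delta$, and (b) $\bar c^{-1}\bar u\,\bar c=\bar v$ in $F/N$. -/

import Mathlib

namespace FlowConj

/-- The alphabet `X^±`: `(x, true)` is the letter `x` and `(x, false)` is its formal inverse. -/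
abbrev Letter (X : Type*) := X × Bool

/-- The formal inverse of a letter. -/
def Letter.inv {X : Type*} (a : Letter X) : Letter X := (a.1, !a.2)

/-- A letter as an element of the free group. -/
def Letter.toFree {X : Type*} (a : Letter X) : FreeGroup X := FreeGroup.mk [a]

theorem Letter.toFree_inv {X : Type*} (a : Letter X) : a.inv.toFree = a.toFree⁻¹ := by
  simp [Letter.inv, Letter.toFree, FreeGroup.inv_mk, FreeGroup.invRev]

theorem Letter.inv_inv {X : Type*} (a : Letter X) : a.inv.inv = a := by
  simp [Letter.inv]

/-- The set of right cosets `H g`: the vertices of the Schreier graph of `H`. -/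
abbrev Vertex {X : Type*} (H : Subgroup (FreeGroup X)) := Quotient (QuotientGroup.rightRel H)

/-- The right coset `H g`. -/
def coset {X : Type*} (H : Subgroup (FreeGroup X)) (g : FreeGroup X) : Vertex H :=
  Quotient.mk (QuotientGroup.rightRel H) g

theorem coset_eq_iff {X : Type*} (H : Subgroup (FreeGroup X)) (g g' : FreeGroup X) :
    coset H g = coset H g' ↔ g' * g⁻¹ ∈ H := by
  unfold coset
  rw [Quotient.eq, QuotientGroup.rightRel_apply]

theorem exists_coset {X : Type*} {H : Subgroup (FreeGroup X)} (p : Vertex H) :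
    ∃ g, coset H g = p := Quotient.exists_rep p

/-- The edge set of the Schreier graph `Sch(X; H)`: all triples `H g → H g x` with label `x`,
for `g` in the free group and `x` in `X^±`; a triple is (origin, terminus, label). -/
def edgeSet {X : Type*} (H : Subgroup (FreeGroup X)) : Set (Vertex H × Vertex H × Letter X) :=
  {e | ∃ (g : FreeGroup X) (a : Letter X), e = (coset H g, coset H (g * a.toFree), a)}

/-- The edges of the Schreier graph `Sch(X; H)`. If `H` is normal this graph is the Cayley graph
`Cay(X; H)` of the quotient group. -/
abbrev Edge {X : Type*} (H : Subgroup (FreeGroup X)) := ↥(edgeSet H)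

/-- The inverse edge. -/
def Edge.inv {X : Type*} {H : Subgroup (FreeGroup X)} (e : Edge H) : Edge H :=
  ⟨(e.1.2.1, e.1.1, e.1.2.2.inv), by
    obtain ⟨_, g, a, rfl⟩ := e
    exact ⟨g * a.toFree, a.inv, by simp [Letter.toFree_inv]⟩⟩

theorem Edge.inv_inv {X : Type*} {H : Subgroup (FreeGroup X)} (e : Edge H) :
    e.inv.inv = e := by
  apply Subtype.ext
  simp [Edge.inv, Letter.inv_inv]

/-- The edge `H g → H g a` labelled by the letter `a`. -/
def edge {X : Type*} (H : Subgroup (FreeGroup X)) (g : FreeGroup X) (a : Letter X) : Edge H :=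
  ⟨(coset H g, coset H (g * a.toFree), a), g, a, rfl⟩

/-- The path in `Sch(X; H)` that starts at the vertex `H g` and has the given label. -/
def wordPath {X : Type*} (H : Subgroup (FreeGroup X)) :
    FreeGroup X → List (Letter X) → List (Edge H)
  | _, [] => []
  | g, a :: l => edge H g a :: wordPath H (g * a.toFree) l

/-- The integer function on edges defined by a path `p`: see `pathFlow_apply`. -/
noncomputable def pathFlow {X : Type*} {H : Subgroup (FreeGroup X)} (p : List (Edge H)) :
    Edge H →₀ ℤ :=
  (p.map fun e => Finsupp.single e 1 - Finsupp.single e.inv 1).sum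

open Classical in
/-- The value of `pathFlow p` at `e` is the number of times `p` traverses `e` minus the number of
times it traverses the inverse of `e`. -/
theorem pathFlow_apply {X : Type*} {H : Subgroup (FreeGroup X)} (p : List (Edge H)) (e : Edge H) :
    pathFlow p e = (p.count e : ℤ) - (p.count e.inv : ℤ) := by
  induction p with
  | nil => simp [pathFlow]
  | cons d p ih =>
    have h : d.inv = e ↔ d = e.inv :=
      ⟨fun h => by rw [← h, Edge.inv_inv], fun h => by rw [h, Edge.inv_inv]⟩
    have h2 : pathFlow (d :: p) = Finsupp.single d 1 - Finsupp.single d.inv 1 + pathFlow p := by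
      simp [pathFlow]
    rw [h2, Finsupp.add_apply, ih, Finsupp.sub_apply, Finsupp.single_apply, Finsupp.single_apply,
      List.count_cons, List.count_cons]
    simp only [h, beq_iff_eq]
    push_cast
    split_ifs <;> ring

open Classical in
/-- The flow `π_w` of `w` in `Sch(X; H)`: the flow of the path that starts at the root `H` and
whose label is the reduced word representing `w`. -/
noncomputable def flow {X : Type*} (H : Subgroup (FreeGroup X)) (w : FreeGroup X) :
    Edge H →₀ ℤ :=
  pathFlow (wordPath H 1 w.toWord)

/-- For `N ≤ H`, the natural projection `N g ↦ H g` on vertices. -/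
def projVertex {X : Type*} {N H : Subgroup (FreeGroup X)} (hNH : N ≤ H) : Vertex N → Vertex H :=
  Quotient.lift (coset H) fun a b hab => by
    rw [coset_eq_iff]
    exact hNH (QuotientGroup.rightRel_apply.1 hab)

/-- For `N ≤ H`, the natural projection `Sch(X; N) → Sch(X; H)` on edges. -/
def projEdge {X : Type*} {N H : Subgroup (FreeGroup X)} (hNH : N ≤ H) (e : Edge N) : Edge H :=
  ⟨(projVertex hNH e.1.1, projVertex hNH e.1.2.1, e.1.2.2), by
    obtain ⟨_, g, a, rfl⟩ := e
    exact ⟨g, a, rfl⟩⟩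

/-- The homomorphism induced by the projection `Sch(X; N) → Sch(X; H)`: the value of
`pushFlow hNH f` at an edge `e'` is the sum of `f e` over all edges `e` that project to `e'`. -/
noncomputable def pushFlow {X : Type*} {N H : Subgroup (FreeGroup X)} (hNH : N ≤ H)
    (f : Edge N →₀ ℤ) : Edge H →₀ ℤ :=
  f.mapDomain (projEdge hNH)

/-- Left multiplication of the vertices of `Cay(X; N)` by elements of the quotient group:
`c̄ · N h = N c h`. -/
def leftVertex {X : Type*} (N : Subgroup (FreeGroup X)) [hN : N.Normal] :
    FreeGroup X ⧸ N → Vertex N → Vertex N :=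
  Quotient.lift₂ (fun c h => coset N (c * h)) fun c h c' h' hc hh => by
    rw [coset_eq_iff]
    have h1 : c⁻¹ * c' ∈ N := QuotientGroup.leftRel_apply.1 hc
    have h2 : h' * h⁻¹ ∈ N := QuotientGroup.rightRel_apply.1 hh
    have h3 := N.mul_mem (hN.conj_mem _ h2 c') (hN.conj_mem _ h1 c)
    have h4 : c' * h' * (c * h)⁻¹ = c' * (h' * h⁻¹) * c'⁻¹ * (c * (c⁻¹ * c') * c⁻¹) := by group
    rw [h4]
    exact h3

/-- Left multiplication of the edges of `Cay(X; N)` by elements of the quotient group. -/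
def leftEdge {X : Type*} (N : Subgroup (FreeGroup X)) [N.Normal] (g : FreeGroup X ⧸ N)
    (e : Edge N) : Edge N :=
  ⟨(leftVertex N g e.1.1, leftVertex N g e.1.2.1, e.1.2.2), by
    obtain ⟨_, h, a, rfl⟩ := e
    obtain ⟨c, rfl⟩ := QuotientGroup.mk_surjective g
    refine ⟨c * h, a, ?_⟩
    change (coset N (c * h), coset N (c * (h * a.toFree)), a) = _
    rw [mul_assoc]⟩

/-- The shift `g · f` of a function on the edges of `Cay(X; N)` by an element `g` of the quotient
group: see `shiftFlow_apply`. -/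
noncomputable def shiftFlow {X : Type*} (N : Subgroup (FreeGroup X)) [N.Normal]
    (g : FreeGroup X ⧸ N) (f : Edge N →₀ ℤ) : Edge N →₀ ℤ :=
  f.mapDomain (leftEdge N g)

theorem leftEdge_leftEdge_of_mul_eq_one {X : Type*} (N : Subgroup (FreeGroup X)) [N.Normal]
    (g g' : FreeGroup X ⧸ N) (hg : g * g' = 1) (e : Edge N) :
    leftEdge N g (leftEdge N g' e) = e := by
  have key : ∀ p : Vertex N, leftVertex N g (leftVertex N g' p) = p := by
    intro p
    obtain ⟨h, rfl⟩ := exists_coset p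
    obtain ⟨c, rfl⟩ := QuotientGroup.mk_surjective g
    obtain ⟨c', rfl⟩ := QuotientGroup.mk_surjective g'
    change coset N (c * (c' * h)) = coset N h
    rw [← QuotientGroup.mk_mul, QuotientGroup.eq_one_iff] at hg
    rw [coset_eq_iff]
    simpa [mul_assoc] using N.inv_mem hg
  apply Subtype.ext
  simp [leftEdge, key]

/-- The defining formula of the shift action: `(g · f)(e) = f(g⁻¹ e)`. -/
theorem shiftFlow_apply {X : Type*} (N : Subgroup (FreeGroup X)) [N.Normal]
    (g : FreeGroup X ⧸ N) (f : Edge N →₀ ℤ) (e : Edge N) :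
    shiftFlow N g f e = f (leftEdge N g⁻¹ e) := by
  have hinj : Function.Injective (leftEdge N g) :=
    Function.LeftInverse.injective (g := leftEdge N g⁻¹)
      (leftEdge_leftEdge_of_mul_eq_one N g⁻¹ g (inv_mul_cancel g))
  have h := Finsupp.mapDomain_apply hinj f (leftEdge N g⁻¹ e)
  rwa [leftEdge_leftEdge_of_mul_eq_one N g g⁻¹ (mul_inv_cancel g)] at h

/-- The `c̄`-shift `c̄ · π_w` of the flow of `w` in `Sch(X; H)`, for `N ≤ H` with `N` normal: the
image in `Sch(X; H)` of the `c̄`-shift of the flow of `w` in the Cayley graph `Cay(X; N)`. -/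
noncomputable def shiftedFlow {X : Type*} {N H : Subgroup (FreeGroup X)} [N.Normal] (hNH : N ≤ H)
    (c : FreeGroup X ⧸ N) (w : FreeGroup X) : Edge H →₀ ℤ :=
  pushFlow hNH (shiftFlow N c (flow N w))

end FlowConj

section AbelianByCyclic

open scoped commutatorElement

variable {G : Type*} [Group G]

theorem zpow_conj_mul_inv_eq_twist {A : Subgroup G} [hA : A.Normal]
    (hcomm : ∀ a ∈ A, ∀ b ∈ A, a * b = b * a) (u : G) {b : G} (hb : b ∈ A) (i : ℤ) :
    ∃ a ∈ A, u ^ i * b * (u ^ i)⁻¹ * b⁻¹ = u⁻¹ * a * u * a⁻¹ := by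
  have conj_mem' : ∀ {a : G}, a ∈ A → u⁻¹ * a * u ∈ A := fun {a} ha => by
    simpa using hA.conj_mem a ha u⁻¹
  induction i with
  | zero => exact ⟨1, A.one_mem, by simp⟩
  | succ i ih =>
    obtain ⟨a, ha, h⟩ := ih
    set c := u ^ (i : ℤ) * b * (u ^ (i : ℤ))⁻¹ with hc
    have hcA : c ∈ A := hA.conj_mem b hb _
    set d := u * c * u⁻¹ with hd
    have hdA : d ∈ A := hA.conj_mem c hcA u
    refine ⟨d⁻¹ * a, A.mul_mem (A.inv_mem hdA) ha, ?_⟩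
    have hcd : c = u⁻¹ * d * u := by rw [hd]; group
    have e1 : u ^ ((i : ℤ) + 1) * b * (u ^ ((i : ℤ) + 1))⁻¹ * b⁻¹ = d * c⁻¹ * (c * b⁻¹) := by
      rw [hd, hc, zpow_add_one, (Commute.refl u).zpow_left i |>.eq]
      group
    rw [e1, h]
    have e2 : u⁻¹ * (d⁻¹ * a) * u * (d⁻¹ * a)⁻¹ = c⁻¹ * ((u⁻¹ * a * u * a⁻¹) * d) := by
      rw [hcd]; group
    rw [e2, hcomm d hdA c⁻¹ (A.inv_mem hcA), mul_assoc,
      hcomm d hdA _ (A.mul_mem (conj_mem' ha) (A.inv_mem ha))]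
  | pred i ih =>
    obtain ⟨a, ha, h⟩ := ih
    set c := u ^ (-(i : ℤ)) * b * (u ^ (-(i : ℤ)))⁻¹ with hc
    have hcA : c ∈ A := hA.conj_mem b hb _
    refine ⟨c * a, A.mul_mem hcA ha, ?_⟩
    have e1 : u ^ (-(i : ℤ) - 1) * b * (u ^ (-(i : ℤ) - 1))⁻¹ * b⁻¹
        = u⁻¹ * c * u * c⁻¹ * (c * b⁻¹) := by
      rw [hc, zpow_sub_one, ((Commute.refl u).inv_right.zpow_left (-(i : ℤ))).eq]
      group
    have e2 : u⁻¹ * (c * a) * u * (c * a)⁻¹ = u⁻¹ * c * u * ((u⁻¹ * a * u * a⁻¹) * c⁻¹) := by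
      group
    rw [e1, h, e2, mul_assoc,
      hcomm c⁻¹ (A.inv_mem hcA) _ (A.mul_mem (conj_mem' ha) (A.inv_mem ha))]

/-- The image of the endomorphism `a ↦ u⁻¹ a u a⁻¹` of an abelian normal subgroup. -/
def twistSubgroup (A : Subgroup G) [hA : A.Normal]
    (hcomm : ∀ a ∈ A, ∀ b ∈ A, a * b = b * a) (u : G) : Subgroup G where
  carrier := {x | ∃ a ∈ A, x = u⁻¹ * a * u * a⁻¹}
  one_mem' := ⟨1, A.one_mem, by simp⟩
  mul_mem' := by
    rintro _ _ ⟨a, ha, rfl⟩ ⟨b, hb, rfl⟩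
    have hb' : u⁻¹ * b * u ∈ A := by simpa using hA.conj_mem b hb u⁻¹
    refine ⟨a * b, A.mul_mem ha hb, ?_⟩
    have e : u⁻¹ * (a * b) * u * (a * b)⁻¹ = u⁻¹ * a * u * (u⁻¹ * b * u * b⁻¹ * a⁻¹) := by group
    rw [e, ← hcomm a⁻¹ (A.inv_mem ha) _ (A.mul_mem hb' (A.inv_mem hb)), mul_assoc _ a⁻¹]
  inv_mem' := by
    rintro _ ⟨a, ha, rfl⟩
    have ha' : u⁻¹ * a⁻¹ * u ∈ A := by simpa using hA.conj_mem _ (A.inv_mem ha) u⁻¹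
    refine ⟨a⁻¹, A.inv_mem ha, ?_⟩
    rw [inv_inv, hcomm _ ha' a ha]
    group

/-- In an abelian-by-cyclic group the commutators are the elements `u⁻¹ a u a⁻¹`. -/
theorem commutator_sup_zpowers_le {A : Subgroup G} [hA : A.Normal]
    (hcomm : ∀ a ∈ A, ∀ b ∈ A, a * b = b * a) (u : G) :
    ⁅A ⊔ Subgroup.zpowers u, A ⊔ Subgroup.zpowers u⁆ ≤ twistSubgroup A hcomm u := by
  rw [Subgroup.commutator_le]
  intro x hx y hy
  obtain ⟨a, ha, _, ⟨i, rfl⟩, rfl⟩ := Subgroup.mem_sup_of_normal_left.1 hx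
  obtain ⟨b, hb, _, ⟨j, rfl⟩, rfl⟩ := Subgroup.mem_sup_of_normal_left.1 hy
  have h1 : u ^ i * b * (u ^ i)⁻¹ * b⁻¹ ∈ twistSubgroup A hcomm u :=
    zpow_conj_mul_inv_eq_twist hcomm u hb i
  have h2 : u ^ j * a * (u ^ j)⁻¹ * a⁻¹ ∈ twistSubgroup A hcomm u :=
    zpow_conj_mul_inv_eq_twist hcomm u ha j
  have hB : u ^ i * b * (u ^ i)⁻¹ ∈ A := hA.conj_mem b hb _
  have hC : u ^ j * a⁻¹ * (u ^ j)⁻¹ ∈ A := hA.conj_mem _ (A.inv_mem ha) _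
  have e : ⁅a * u ^ i, b * u ^ j⁆ =
      (u ^ i * b * (u ^ i)⁻¹ * b⁻¹) * (u ^ j * a * (u ^ j)⁻¹ * a⁻¹)⁻¹ := by
    have e1 : ⁅a * u ^ i, b * u ^ j⁆ =
        a * (u ^ i * b * (u ^ i)⁻¹) * ((u ^ j * a⁻¹ * (u ^ j)⁻¹) * b⁻¹) := by
      rw [commutatorElement_def]; group
    rw [e1, hcomm a ha _ hB, hcomm _ hC _ (A.inv_mem hb), mul_assoc, ← mul_assoc a b⁻¹,
      hcomm a ha _ (A.inv_mem hb)]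
    group
  rw [e]
  exact mul_mem h1 (inv_mem h2)

theorem exists_twist_of_mem_commutator (N : Subgroup G) [N.Normal] (u : G) {x : G}
    (hx : x ∈ ⁅N ⊔ Subgroup.zpowers u, N ⊔ Subgroup.zpowers u⁆) :
    ∃ a ∈ N, (x : G ⧸ ⁅N, N⁆) = (u⁻¹ * a * u * a⁻¹ : G) := by
  let q := QuotientGroup.mk' ⁅N, N⁆
  have hA : (N.map q).Normal := Subgroup.Normal.map ‹_› q (QuotientGroup.mk'_surjective _)
  have hcomm : ∀ a ∈ N.map q, ∀ b ∈ N.map q, a * b = b * a := by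
    rintro _ ⟨a, ha, rfl⟩ _ ⟨b, hb, rfl⟩
    rw [← commutatorElement_eq_one_iff_mul_comm, ← map_commutatorElement]
    exact (QuotientGroup.eq_one_iff _).2 (Subgroup.commutator_mem_commutator ha hb)
  have h := Subgroup.mem_map_of_mem q hx
  rw [Subgroup.map_commutator, Subgroup.map_sup, MonoidHom.map_zpowers] at h
  obtain ⟨_, ⟨a, ha, rfl⟩, h⟩ := commutator_sup_zpowers_le hcomm (q u) h
  exact ⟨a, ha, h⟩

end AbelianByCyclic

namespace FlowConj

variable {X : Type*}

theorem coset_mul_eq {H : Subgroup (FreeGroup X)} {g g' : FreeGroup X}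
    (h : coset H g = coset H g') (w : FreeGroup X) : coset H (g * w) = coset H (g' * w) := by
  rw [coset_eq_iff] at h ⊢
  simpa [mul_assoc] using h

theorem edge_congr {H : Subgroup (FreeGroup X)} {g g' : FreeGroup X}
    (h : coset H g = coset H g') (a : Letter X) : edge H g a = edge H g' a := by
  apply Subtype.ext
  simp [edge, h, coset_mul_eq h]

theorem edge_inv (H : Subgroup (FreeGroup X)) (g : FreeGroup X) (a : Letter X) :
    (edge H g a).inv = edge H (g * a.toFree) a.inv := by
  apply Subtype.ext
  simp [edge, Edge.inv, Letter.toFree_inv]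

theorem wordPath_congr {H : Subgroup (FreeGroup X)} (l : List (Letter X)) :
    ∀ {g g' : FreeGroup X}, coset H g = coset H g' → wordPath H g l = wordPath H g' l := by
  induction l with
  | nil => intros; rfl
  | cons a l ih =>
    intro g g' h
    simp only [wordPath, edge_congr h, ih (coset_mul_eq h a.toFree)]

theorem pathFlow_nil {H : Subgroup (FreeGroup X)} : pathFlow ([] : List (Edge H)) = 0 := rfl

theorem pathFlow_cons {H : Subgroup (FreeGroup X)} (e : Edge H) (p : List (Edge H)) :
    pathFlow (e :: p) = Finsupp.single e 1 - Finsupp.single e.inv 1 + pathFlow p := by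
  simp [pathFlow]

theorem pathFlow_append {H : Subgroup (FreeGroup X)} (p q : List (Edge H)) :
    pathFlow (p ++ q) = pathFlow p + pathFlow q := by
  simp [pathFlow]

theorem wordPath_append (H : Subgroup (FreeGroup X)) (l l' : List (Letter X)) :
    ∀ g : FreeGroup X,
      wordPath H g (l ++ l') = wordPath H g l ++ wordPath H (g * FreeGroup.mk l) l' := by
  induction l with
  | nil => intro g; simp [wordPath, ← FreeGroup.one_eq_mk]
  | cons a l ih =>
    intro g
    have e : FreeGroup.mk (a :: l) = a.toFree * FreeGroup.mk l := by
      simp [Letter.toFree]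
    simp [wordPath, ih, e, mul_assoc]

theorem pathFlow_wordPath_step (H : Subgroup (FreeGroup X)) (g : FreeGroup X)
    {l l' : List (Letter X)} (h : FreeGroup.Red.Step l l') :
    pathFlow (wordPath H g l) = pathFlow (wordPath H g l') := by
  obtain @⟨l₁, l₂, x, b⟩ := h
  have hx : Letter.toFree (x, b) * Letter.toFree (x, !b) = 1 := by
    rw [show ((x, !b) : Letter X) = Letter.inv (x, b) from rfl, Letter.toFree_inv,
      mul_inv_cancel]
  have hi : edge H (g * FreeGroup.mk l₁ * Letter.toFree (x, b)) (x, !b)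
      = (edge H (g * FreeGroup.mk l₁) (x, b)).inv := (edge_inv H _ _).symm
  simp only [wordPath_append, pathFlow_append, wordPath, pathFlow_cons, hi, Edge.inv_inv]
  rw [mul_assoc (g * FreeGroup.mk l₁), hx, mul_one]
  abel

theorem pathFlow_wordPath_red (H : Subgroup (FreeGroup X)) (g : FreeGroup X)
    {l l' : List (Letter X)} (h : FreeGroup.Red l l') :
    pathFlow (wordPath H g l) = pathFlow (wordPath H g l') := by
  induction h with
  | refl => rfl
  | tail _ h ih => rw [ih, pathFlow_wordPath_step H g h]

open Classical in
/-- The flow in `Sch(X; H)` of the path from `H g` labelled by the reduced word `w`. -/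
noncomputable def flowFrom (H : Subgroup (FreeGroup X)) (g w : FreeGroup X) : Edge H →₀ ℤ :=
  pathFlow (wordPath H g w.toWord)

theorem flowFrom_one_left (H : Subgroup (FreeGroup X)) (w : FreeGroup X) :
    flowFrom H 1 w = flow H w := rfl

theorem flowFrom_congr {H : Subgroup (FreeGroup X)} {g g' : FreeGroup X}
    (h : coset H g = coset H g') (w : FreeGroup X) : flowFrom H g w = flowFrom H g' w := by
  rw [flowFrom, flowFrom, wordPath_congr _ h]

theorem flowFrom_mk (H : Subgroup (FreeGroup X)) (g : FreeGroup X) (l : List (Letter X)) :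
    flowFrom H g (FreeGroup.mk l) = pathFlow (wordPath H g l) := by
  classical
  rw [flowFrom, FreeGroup.toWord_mk]
  exact (pathFlow_wordPath_red H g FreeGroup.reduce.red).symm

theorem flowFrom_mul (H : Subgroup (FreeGroup X)) (g w w' : FreeGroup X) :
    flowFrom H g (w * w') = flowFrom H g w + flowFrom H (g * w) w' := by
  obtain ⟨l, rfl⟩ := Quot.exists_rep w
  obtain ⟨l', rfl⟩ := Quot.exists_rep w'
  change flowFrom H g (FreeGroup.mk l * FreeGroup.mk l') =
    flowFrom H g (FreeGroup.mk l) + flowFrom H (g * FreeGroup.mk l) (FreeGroup.mk l')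
  rw [FreeGroup.mul_mk, flowFrom_mk, flowFrom_mk, flowFrom_mk, wordPath_append, pathFlow_append]

theorem flowFrom_one_right (H : Subgroup (FreeGroup X)) (g : FreeGroup X) :
    flowFrom H g 1 = 0 := by
  rw [FreeGroup.one_eq_mk, flowFrom_mk]
  rfl

theorem coset_eq_coset_one {H : Subgroup (FreeGroup X)} {h : FreeGroup X} (hh : h ∈ H) :
    coset H h = coset H 1 := by
  rw [coset_eq_iff]
  simpa using H.inv_mem hh

/-- On `H` itself the flow in `Sch(X; H)` is a homomorphism. -/
noncomputable def flowHom (H : Subgroup (FreeGroup X)) : H →* Multiplicative (Edge H →₀ ℤ) where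
  toFun h := Multiplicative.ofAdd (flow H h)
  map_one' := by
    rw [← flowFrom_one_left, Subgroup.coe_one, flowFrom_one_right, ofAdd_zero]
  map_mul' h h' := by
    rw [← ofAdd_add, Subgroup.coe_mul, ← flowFrom_one_left, flowFrom_mul, one_mul,
      flowFrom_congr (coset_eq_coset_one h.2), flowFrom_one_left, flowFrom_one_left]

theorem flow_conj {H : Subgroup (FreeGroup X)} {c v : FreeGroup X} (h : c * v * c⁻¹ ∈ H) :
    flow H (c * v * c⁻¹) = flowFrom H c v := by
  have h1 : flowFrom H 1 (c * v * c⁻¹ * c) = flowFrom H 1 (c * v) := by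
    rw [inv_mul_cancel_right]
  rw [flowFrom_mul, flowFrom_mul H 1 c v, one_mul, one_mul,
    flowFrom_congr (coset_eq_coset_one h), add_comm] at h1
  exact add_left_cancel h1

/-- A chosen representative of a vertex of `Sch(X; H)`. -/
noncomputable def vertexRep {H : Subgroup (FreeGroup X)} (p : Vertex H) : FreeGroup X :=
  (exists_coset p).choose

theorem coset_vertexRep {H : Subgroup (FreeGroup X)} (p : Vertex H) :
    coset H (vertexRep p) = p := (exists_coset p).choose_spec

theorem rep_mul_mem {H : Subgroup (FreeGroup X)} (g w : FreeGroup X) :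
    vertexRep (coset H g) * w * (vertexRep (coset H (g * w)))⁻¹ ∈ H := by
  rw [← coset_eq_iff, coset_vertexRep]
  exact coset_mul_eq (coset_vertexRep (coset H g)).symm w |>.symm ▸ rfl

/-- The class in the abelianization of `H` of the loop that follows `w` from the
representative of `H g`. -/
noncomputable def loopClass (H : Subgroup (FreeGroup X)) (g w : FreeGroup X) :
    Additive (Abelianization H) :=
  Additive.ofMul (Abelianization.of
    ⟨vertexRep (coset H g) * w * (vertexRep (coset H (g * w)))⁻¹, rep_mul_mem g w⟩)

theorem loopClass_mul (H : Subgroup (FreeGroup X)) (g w w' : FreeGroup X) :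
    loopClass H g (w * w') = loopClass H g w + loopClass H (g * w) w' := by
  rw [loopClass, loopClass, loopClass, ← ofMul_mul, ← map_mul]
  congr 2
  apply Subtype.ext
  simp [mul_assoc]

theorem loopClass_one (H : Subgroup (FreeGroup X)) (g : FreeGroup X) : loopClass H g 1 = 0 := by
  simpa using loopClass_mul H g 1 1

theorem loopClass_congr {H : Subgroup (FreeGroup X)} {g g' : FreeGroup X}
    (h : coset H g = coset H g') (w : FreeGroup X) : loopClass H g w = loopClass H g' w := by
  simp only [loopClass, h, coset_mul_eq h w]

/-- The loop class of an edge with positive label, and zero on edges with negative label. -/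
noncomputable def edgeClass {H : Subgroup (FreeGroup X)} (e : Edge H) :
    Additive (Abelianization H) :=
  if e.1.2.2.2 then loopClass H (vertexRep e.1.1) e.1.2.2.toFree else 0

theorem edgeClass_edge (H : Subgroup (FreeGroup X)) (g : FreeGroup X) (a : Letter X) :
    edgeClass (edge H g a) = if a.2 then loopClass H g a.toFree else 0 := by
  simp only [edgeClass, edge, loopClass_congr (coset_vertexRep (coset H g))]

theorem edgeClass_sub_inv (H : Subgroup (FreeGroup X)) (g : FreeGroup X) (a : Letter X) :
    edgeClass (edge H g a) - edgeClass (edge H g a).inv = loopClass H g a.toFree := by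
  rw [edge_inv, edgeClass_edge, edgeClass_edge]
  have h : 0 = loopClass H g a.toFree + loopClass H (g * a.toFree) a.inv.toFree := by
    rw [← loopClass_mul, Letter.toFree_inv, mul_inv_cancel, loopClass_one]
  obtain ⟨x, b⟩ := a
  cases b
  · simpa [Letter.inv] using (eq_neg_of_add_eq_zero_left h.symm).symm
  · simp [Letter.inv]

/-- The linear extension of `edgeClass` to finitely supported functions. -/
noncomputable def classHom (H : Subgroup (FreeGroup X)) :
    (Edge H →₀ ℤ) →+ Additive (Abelianization H) :=
  Finsupp.liftAddHom fun e => (zmultiplesHom _) (edgeClass e)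

theorem classHom_single (H : Subgroup (FreeGroup X)) (e : Edge H) :
    classHom H (Finsupp.single e 1) = edgeClass e := by
  simp [classHom]

theorem classHom_pathFlow (H : Subgroup (FreeGroup X)) (l : List (Letter X)) :
    ∀ g, classHom H (pathFlow (wordPath H g l)) = loopClass H g (FreeGroup.mk l) := by
  induction l with
  | nil => intro g; simp [wordPath, pathFlow_nil, ← FreeGroup.one_eq_mk, loopClass_one]
  | cons a l ih =>
    intro g
    have e : FreeGroup.mk (a :: l) = a.toFree * FreeGroup.mk l := by simp [Letter.toFree]
    rw [wordPath, pathFlow_cons, map_add, map_sub, classHom_single, classHom_single,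
      edgeClass_sub_inv, ih, e, loopClass_mul]

theorem loopClass_one_left {H : Subgroup (FreeGroup X)} (h : H) :
    loopClass H 1 h = Additive.ofMul (Abelianization.of h) := by
  have hr : vertexRep (coset H 1) ∈ H := by
    have := (coset_eq_iff H 1 _).1 (coset_vertexRep (coset H 1)).symm
    simpa using this
  have hs : (⟨vertexRep (coset H 1) * h * (vertexRep (coset H (1 * (h : FreeGroup X))))⁻¹,
      rep_mul_mem 1 _⟩ : H) = ⟨_, hr⟩ * h * ⟨_, hr⟩⁻¹ := by
    apply Subtype.ext
    simp [coset_eq_coset_one h.2]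
  rw [loopClass, hs, map_mul Abelianization.of, map_mul Abelianization.of,
    map_inv Abelianization.of, mul_inv_cancel_comm]

/-- The flow in `Sch(X; H)` determines elements of `H` modulo the commutator subgroup. -/
theorem flow_eq_iff {H : Subgroup (FreeGroup X)} {x y : FreeGroup X} (hx : x ∈ H) (hy : y ∈ H) :
    flow H x = flow H y ↔ x⁻¹ * y ∈ ⁅H, H⁆ := by
  have hmem : x⁻¹ * y ∈ ⁅H, H⁆ ↔ (⟨x, hx⟩ : H)⁻¹ * ⟨y, hy⟩ ∈ commutator H := by
    rw [← Subgroup.map_subtype_commutator]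
    exact Subgroup.mem_map_iff_mem (f := H.subtype) H.subtype_injective (x := (⟨x, hx⟩ : H)⁻¹ * ⟨y, hy⟩)
  rw [hmem]
  constructor
  · intro h
    have key : ∀ z : H, classHom H (flow H z) = Additive.ofMul (Abelianization.of z) := fun z => by
      classical
      rw [← loopClass_one_left, ← flowFrom_one_left, flowFrom, classHom_pathFlow,
        FreeGroup.mk_toWord]
    have h' := congrArg (classHom H) h
    rw [key ⟨x, hx⟩, key ⟨y, hy⟩] at h'
    exact QuotientGroup.eq.1 (Additive.ofMul.injective h')
  · intro h
    have h' := Abelianization.commutator_subset_ker (flowHom H) h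
    rw [MonoidHom.mem_ker, map_mul, map_inv, inv_mul_eq_one] at h'
    exact Multiplicative.ofAdd.injective h'

theorem projEdge_inv {N H : Subgroup (FreeGroup X)} (hNH : N ≤ H) (e : Edge N) :
    projEdge hNH e.inv = (projEdge hNH e).inv := rfl

theorem leftEdge_inv (N : Subgroup (FreeGroup X)) [N.Normal] (g : FreeGroup X ⧸ N) (e : Edge N) :
    leftEdge N g e.inv = (leftEdge N g e).inv := rfl

theorem projEdge_leftEdge_edge {N H : Subgroup (FreeGroup X)} [N.Normal] (hNH : N ≤ H)
    (c g : FreeGroup X) (a : Letter X) :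
    projEdge hNH (leftEdge N (c : FreeGroup X ⧸ N) (edge N g a)) = edge H (c * g) a := by
  apply Subtype.ext
  change (coset H (c * g), coset H (c * (g * a.toFree)), a) = _
  rw [← mul_assoc]
  rfl

theorem pushFlow_shiftFlow_pathFlow {N H : Subgroup (FreeGroup X)} [N.Normal] (hNH : N ≤ H)
    (c : FreeGroup X) (l : List (Letter X)) :
    ∀ g, pushFlow hNH (shiftFlow N (c : FreeGroup X ⧸ N) (pathFlow (wordPath N g l)))
      = pathFlow (wordPath H (c * g) l) := by
  induction l with
  | nil => intro g; simp [wordPath, pathFlow_nil, pushFlow, shiftFlow]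
  | cons a l ih =>
    intro g
    have ih' := ih (g * a.toFree)
    simp only [pushFlow, shiftFlow] at ih' ⊢
    rw [wordPath, wordPath, pathFlow_cons, pathFlow_cons, Finsupp.mapDomain_add,
      Finsupp.mapDomain_add, ih', sub_eq_add_neg, Finsupp.mapDomain_add, Finsupp.mapDomain_add,
      ← Finsupp.single_neg, Finsupp.mapDomain_single, Finsupp.mapDomain_single,
      Finsupp.mapDomain_single, Finsupp.mapDomain_single, leftEdge_inv, projEdge_inv,
      projEdge_leftEdge_edge, Finsupp.single_neg, ← sub_eq_add_neg, mul_assoc]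

theorem shiftedFlow_eq_flowFrom {N H : Subgroup (FreeGroup X)} [N.Normal] (hNH : N ≤ H)
    (c v : FreeGroup X) : shiftedFlow hNH (c : FreeGroup X ⧸ N) v = flowFrom H c v := by
  classical
  rw [shiftedFlow, flow, pushFlow_shiftFlow_pathFlow, mul_one, flowFrom]

end FlowConj

theorem mainTheorem10 {X : Type*} (N : Subgroup (FreeGroup X)) [N.Normal] (u v : FreeGroup X) :
    IsConj (u : FreeGroup X ⧸ ⁅N, N⁆) (v : FreeGroup X ⧸ ⁅N, N⁆) ↔
      ∃ c : FreeGroup X,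
        FlowConj.flow (N ⊔ Subgroup.zpowers u) u =
            FlowConj.shiftedFlow (H := N ⊔ Subgroup.zpowers u) le_sup_left
              (c : FreeGroup X ⧸ N) v ∧
          (c : FreeGroup X ⧸ N)⁻¹ * (u : FreeGroup X ⧸ N) * (c : FreeGroup X ⧸ N) =
            (v : FreeGroup X ⧸ N) := by
  set M := N ⊔ Subgroup.zpowers u with hM
  have hNM : N ≤ M := le_sup_left
  have huM : u ∈ M := Subgroup.mem_sup_right (Subgroup.mem_zpowers u)
  have hconj : ∀ c : FreeGroup X,
      (c : FreeGroup X ⧸ N)⁻¹ * (u : FreeGroup X ⧸ N) * (c : FreeGroup X ⧸ N) =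
        (v : FreeGroup X ⧸ N) ↔ u⁻¹ * (c * v * c⁻¹) ∈ N := fun c => by
    rw [← QuotientGroup.eq, QuotientGroup.mk_mul, QuotientGroup.mk_mul, QuotientGroup.mk_inv,
      eq_mul_inv_iff_mul_eq, mul_assoc, inv_mul_eq_iff_eq_mul]
  have hmemM : ∀ {c : FreeGroup X}, u⁻¹ * (c * v * c⁻¹) ∈ N → c * v * c⁻¹ ∈ M := fun h => by
    simpa using M.mul_mem huM (hNM h)
  constructor
  · intro h
    obtain ⟨q, hq⟩ := isConj_iff.1 h.symm
    obtain ⟨c, rfl⟩ := QuotientGroup.mk_surjective q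
    have h1 : u⁻¹ * (c * v * c⁻¹) ∈ ⁅N, N⁆ := QuotientGroup.eq.1 hq.symm
    have h2 : u⁻¹ * (c * v * c⁻¹) ∈ N := Subgroup.commutator_le_left N N h1
    refine ⟨c, ?_, (hconj c).2 h2⟩
    rw [FlowConj.shiftedFlow_eq_flowFrom, ← FlowConj.flow_conj (hmemM h2),
      FlowConj.flow_eq_iff huM (hmemM h2)]
    exact Subgroup.commutator_mono hNM hNM h1
  · rintro ⟨c, h1, h2⟩
    rw [hconj] at h2
    rw [FlowConj.shiftedFlow_eq_flowFrom, ← FlowConj.flow_conj (hmemM h2),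
      FlowConj.flow_eq_iff huM (hmemM h2)] at h1
    obtain ⟨a, -, ha⟩ := exists_twist_of_mem_commutator N u h1
    have h3 : ((c * v * c⁻¹ : FreeGroup X) : FreeGroup X ⧸ ⁅N, N⁆) = (a * u * a⁻¹ : FreeGroup X) := by
      rw [mul_assoc u⁻¹ a u, mul_assoc u⁻¹, QuotientGroup.mk_mul, QuotientGroup.mk_mul _ u⁻¹] at ha
      exact mul_left_cancel ha
    have hu : IsConj (u : FreeGroup X ⧸ ⁅N, N⁆) (a * u * a⁻¹ : FreeGroup X) :=
      isConj_iff.2 ⟨a, rfl⟩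
    have hv : IsConj (v : FreeGroup X ⧸ ⁅N, N⁆) (c * v * c⁻¹ : FreeGroup X) :=
      isConj_iff.2 ⟨c, rfl⟩
    exact hu.trans (h3 ▸ hv.symm)
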